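/- Let $r\ge 1$ and let $n_1,\dots,n_r$, $m_1,\dots,m_r$ be positive integers with $m_k\le n_k$ for all $k$. For matrices $A_k\in\mathbb R^{n_k\times m_k}$ and a tensor $S\in\mathbb R^{m_1\times\cdots\times m_r}$ let $\boldsymbol A\cdot S\in\mathbb R^{n_1\times\cdots\times n_r}$ be the Tucker product $$(\boldsymbol A\cdot S)_{i_1,\dots,i_r}=\sum_{j_1=1}^{m_1}\cdots\sum_{j_r=1}^{m_r}(A_1)_{i_1j_1}\cdots(A_r)_{i_rj_r}\,S_{j_1,\dots,j_r},$$ and let $$\mathcal M(m_1,\dots,m_r)=\{\boldsymbol A\cdot S:\ A_k\in\mathbb R^{n_k\times m_k}\ (k=1,\dots,r),\ S\in\mathbb R^{m_1\times\cdots\times m_r}\}.$$ The multilinear rank of $T\in\mathbb R^{n_1\times\cdots\times n_r}$ is the tuple whose $k$-th entry is the rank of the $n_k\times\prod_{l\ne k}n_l$ matrix whose columns are the mode-$k$ fibers of $T$. Let $\mathcal T(d_1,\dots,d_r)$ be the set of tensors in $\mathbb R^{n_1\times\cdots\times n_r}$ of multilinear rank exactly $(d_1,\dots,d_r)$, and let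 $$\overline{\mathcal T}(d_1,\dots,d_r)=\bigcup_{d_1'\le d_1,\dots,d_r'\le d_r}\mathcal T(d_1',\dots,d_r')$$ be the Tucker (subspace) variety. Then, with $d_k=\min\{m_k,\prod_{l\ne k}m_l\}$, $$\mathcal M(m_1,\dots,m_r)=\overline{\mathcal T}(d_1,\dots,d_r),$$ and the dimension of this real algebraic set (the Krull dimension of its ring of real polynomial functions) is $$\dim\mathcal M(m_1,\dots,m_r)=\sum_{k=1}^r\bigl(d_kn_k-d_k^2\bigr)+\prod_{k=1}^r d_k.$$ -/

import Mathlib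

/-- Real arrays of format `n 1 × ⋯ × n r`. -/
abbrev RealTensor {r : ℕ} (n : Fin r → ℕ) : Type :=
  (∀ k, Fin (n k)) → ℝ

/-- The Tucker product `A · S`, whose entry at `(i₁, …, i_r)` is
`∑_{j₁, …, j_r} (A₁)_{i₁ j₁} ⋯ (A_r)_{i_r j_r} S_{j₁ … j_r}`. -/
def tuckerProduct {r : ℕ} {n m : Fin r → ℕ}
    (A : ∀ k, Matrix (Fin (n k)) (Fin (m k)) ℝ) (S : RealTensor m) : RealTensor n :=
  fun i => ∑ j, (∏ k, A k (i k) (j k)) * S j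

/-- The mode-`k` matricization: the `n k × ∏_{l ≠ k} n l` matrix whose columns are the
mode-`k` fibers of `T`. -/
def modeMatricization {r : ℕ} {n : Fin r → ℕ} (k : Fin r) (T : RealTensor n) :
    Matrix (Fin (n k)) (∀ l : {l : Fin r // l ≠ k}, Fin (n l)) ℝ :=
  Matrix.of fun i j => T ((Equiv.piSplitAt k fun l => Fin (n l)).symm (i, j))

/-- The multilinear (Tucker) rank of a tensor. -/
noncomputable def multilinearRank {r : ℕ} {n : Fin r → ℕ} (T : RealTensor n) : Fin r → ℕ :=
  fun k => (modeMatricization k T).rank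

/-- The Tucker manifold: the tensors of format `n` whose multilinear rank is exactly `d`. -/
def tuckerManifold {r : ℕ} (n d : Fin r → ℕ) : Set (RealTensor n) :=
  {T | multilinearRank T = d}

/-- The Tucker (subspace) variety: the union of the Tucker manifolds of multilinear
rank `d' ≤ d` (componentwise). -/
def tuckerVariety {r : ℕ} (n d : Fin r → ℕ) : Set (RealTensor n) :=
  ⋃ d' ∈ Set.Iic d, tuckerManifold n d'

/-- The set of all tensors `A · S` of format `n`, where `A k` ranges over all `n k × m k` matrices
and `S` over all core tensors of format `m`. -/
def tuckerImage {r : ℕ} (n m : Fin r → ℕ) : Set (RealTensor n) :=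
  {T | ∃ (A : ∀ k, Matrix (Fin (n k)) (Fin (m k)) ℝ) (S : RealTensor m), T = tuckerProduct A S}

/-- `d_k = min {m_k, ∏_{l ≠ k} m_l}`. -/
def effectiveRank {r : ℕ} (m : Fin r → ℕ) (k : Fin r) : ℕ :=
  min (m k) (∏ l ∈ Finset.univ.erase k, m l)

/-- The dimension of a real algebraic (or semialgebraic) subset `X` of `ℝ^σ`: the Krull dimension
of its ring of polynomial functions `ℝ[x_i : i ∈ σ] / I(X)`. -/
noncomputable def realAlgebraicDim {σ : Type} (X : Set (σ → ℝ)) : WithBot ℕ∞ :=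
  ringKrullDim (MvPolynomial σ ℝ ⧸ MvPolynomial.vanishingIdeal ℝ X)

/-! Matricizing `A · S` in mode `k` gives `A k` times the matricized core times a Kronecker product,
so its rank is at most `effectiveRank m k`. Conversely, if every mode-`k` rank is at most `m k`,
projections onto the column spaces that factor through `ℝ^(m k)` fix `T` and exhibit it as a Tucker
product.

For the dimension, the core is first shrunk to format `d = effectiveRank m`. Factors with identity
top block then parametrize a Zariski-dense subset without redundancy: core entries are entries of
the tensor, and Cramer's rule recovers the factors as rational functions of it, because `d k ≤ ∏ l ≠
k, d l`. Hence the coordinate ring has transcendence degree equal to the number of chart parameters,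
and this is its Krull dimension by Noether normalization. -/

/-! ### Krull dimension, transcendence degree and polynomial parametrizations -/

theorem ringKrullDim_eq_of_isIntegral (R S : Type*) [CommRing R] [CommRing S] [Algebra R S]
    [Algebra.IsIntegral R S] (hinj : Function.Injective (algebraMap R S)) :
    ringKrullDim R = ringKrullDim S := by
  apply le_antisymm
  -- By injectivity some prime lies over the bottom of the chain; going-up lifts the rest.
  · refine iSup_le fun l => ?_
    obtain ⟨Q, -, hQ, hQl⟩ := Ideal.exists_ideal_over_prime_of_isIntegral (S := S)
      l.head.asIdeal ⊥ (by
        rw [← RingHom.ker_eq_comap_bot, (RingHom.injective_iff_ker_eq_bot _).mp hinj]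
        exact bot_le)
    have : Q.LiesOver l.head.asIdeal := ⟨hQl.symm⟩
    obtain ⟨L, hL, -⟩ := Ideal.exists_ltSeries_of_hasGoingUp l Q
    rw [← hL]
    exact Order.LTSeries.length_le_krullDim L
  -- Incomparability: contraction of primes is strictly monotone.
  · exact Order.krullDim_le_of_strictMono (PrimeSpectrum.comap (algebraMap R S))
      fun I J h => Ideal.IsIntegral.comap_lt_comap h

/-- Noether normalization makes `A` integral over a polynomial ring, and additivity of transcendence
degree forces `D` variables. -/
theorem ringKrullDim_eq_of_trdeg_eq (k A : Type) [Field k] [CommRing A] [IsDomain A] [Algebra k A]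
    [Algebra.FiniteType k A] {D : ℕ} (hD : Algebra.trdeg k A = D) :
    ringKrullDim A = D := by
  obtain ⟨s, g, hg, hint⟩ := exists_integral_inj_algHom_of_fg k A
  algebraize [g.toRingHom]
  have hinj : Function.Injective (algebraMap (MvPolynomial (Fin s) k) A) := hg
  have : Algebra.IsIntegral (MvPolynomial (Fin s) k) A := ⟨hint⟩
  have : FaithfulSMul (MvPolynomial (Fin s) k) A :=
    (faithfulSMul_iff_algebraMap_injective _ _).mpr hinj
  have h1 := trdeg_add_eq k (MvPolynomial (Fin s) k) (A := A)
  rw [trdeg_eq_zero (R := MvPolynomial (Fin s) k), MvPolynomial.trdeg_of_isDomain, hD] at h1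
  simp only [Cardinal.mk_fin, Cardinal.lift_natCast, add_zero, Nat.cast_inj] at h1
  rw [← ringKrullDim_eq_of_isIntegral _ _ hinj, MvPolynomial.ringKrullDim_of_isNoetherianRing,
    ringKrullDim_eq_zero_of_field, zero_add, Nat.card_fin, h1]

/-- A polynomial ring is algebraic over any subalgebra into which each variable can be multiplied
by a nonzero element of that subalgebra. -/
theorem MvPolynomial.isAlgebraic_of_mul_X_mem {k τ : Type} [Field k]
    (R : Subalgebra k (MvPolynomial τ k))
    (h : ∀ i, ∃ s ∈ R, s ≠ 0 ∧ s * MvPolynomial.X i ∈ R) :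
    Algebra.IsAlgebraic R (MvPolynomial τ k) := by
  refine ⟨fun f => ?_⟩
  induction f using MvPolynomial.induction_on with
  | C a => exact isAlgebraic_algebraMap (⟨MvPolynomial.C a, R.algebraMap_mem a⟩ : R)
  | add p q hp hq => exact hp.add hq
  | mul_X p i hp =>
    refine hp.mul ?_
    obtain ⟨s, hs, hs0, hsX⟩ := h i
    -- The variable is a root of the linear polynomial `s T - s X_i`, whose leading coefficient is
    -- nonzero.
    refine ⟨Polynomial.C ⟨s, hs⟩ * Polynomial.X - Polynomial.C ⟨_, hsX⟩, fun h0 => hs0 ?_, ?_⟩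
    · have := congrArg (fun f => Polynomial.coeff f 1) h0
      simpa [Polynomial.coeff_C, Subtype.ext_iff] using this
    · simp

/-- If a set has the same vanishing ideal as the image of a polynomial map `p` on an affine space
and the coordinate ring of that space is algebraic over the algebra generated by `p`, then
the dimension of the set is that of the affine space. -/
theorem realAlgebraicDim_eq_card {σ τ : Type} [Finite σ] [Fintype τ] (X : Set (σ → ℝ))
    (p : σ → MvPolynomial τ ℝ)
    (hX : ∀ f : MvPolynomial σ ℝ, f ∈ MvPolynomial.vanishingIdeal ℝ X ↔
      ∀ x : τ → ℝ, MvPolynomial.eval (fun i => MvPolynomial.eval x (p i)) f = 0)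
    (halg : Algebra.IsAlgebraic (MvPolynomial.aeval (R := ℝ) p).range (MvPolynomial τ ℝ)) :
    realAlgebraicDim X = (Fintype.card τ : ℕ) := by
  have hker : MvPolynomial.vanishingIdeal ℝ X = RingHom.ker (MvPolynomial.aeval (R := ℝ) p) := by
    ext f
    rw [hX, RingHom.mem_ker]
    have key : ∀ x : τ → ℝ, MvPolynomial.eval x (MvPolynomial.aeval p f) =
        MvPolynomial.eval (fun i => MvPolynomial.eval x (p i)) f := by
      intro x
      rw [MvPolynomial.aeval_def, MvPolynomial.eval_eval₂]
      simp only [MvPolynomial.eval, MvPolynomial.algebraMap_eq]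
      congr 1
      ext
      simp
    constructor
    · intro h
      exact MvPolynomial.funext fun x => by rw [key, h x, map_zero]
    · intro h x
      rw [← key, h, map_zero]
  have e := Ideal.quotientKerEquivRange (MvPolynomial.aeval (R := ℝ) p)
  have htr : Algebra.trdeg ℝ (MvPolynomial.aeval (R := ℝ) p).range = (Fintype.card τ : ℕ) := by
    have : FaithfulSMul ℝ (MvPolynomial.aeval (R := ℝ) p).range :=
      (faithfulSMul_iff_algebraMap_injective _ _).mpr (algebraMap ℝ _).injective
    have h1 := trdeg_add_eq ℝ (MvPolynomial.aeval (R := ℝ) p).range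
      (A := MvPolynomial τ ℝ)
    rw [trdeg_eq_zero (A := MvPolynomial τ ℝ), MvPolynomial.trdeg_of_isDomain] at h1
    simpa using h1
  have : Algebra.FiniteType ℝ (MvPolynomial.aeval (R := ℝ) p).range :=
    Algebra.FiniteType.of_surjective (MvPolynomial.aeval (R := ℝ) p).rangeRestrict
      (MvPolynomial.aeval (R := ℝ) p).rangeRestrict_surjective
  rw [realAlgebraicDim, hker, ← ringKrullDim_eq_of_trdeg_eq _ _ htr]
  exact ringKrullDim_eq_of_ringEquiv e.toRingEquiv

/-- `P * Q` is a projection onto the column space of `M`, factored through an embedding of that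
space in `ℝ^e`. -/
theorem Matrix.exists_mul_mul_eq_of_rank_le {ι : Type} [Fintype ι] [DecidableEq ι] {n e : ℕ}
    (M : Matrix (Fin n) ι ℝ) (h : M.rank ≤ e) :
    ∃ (P : Matrix (Fin n) (Fin e) ℝ) (Q : Matrix (Fin e) (Fin n) ℝ), P * Q * M = M := by
  let V := LinearMap.range M.mulVecLin
  obtain ⟨π, hπ⟩ := V.subtype.exists_leftInverse_of_injective V.ker_subtype
  obtain ⟨f, hf⟩ : ∃ f : V →ₗ[ℝ] (Fin e → ℝ), Function.Injective f := by
    rw [← rank_le_iff_exists_linearMap, ← Module.finrank_eq_rank, ← Module.finrank_eq_rank,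
      Nat.cast_le]
    rw [Module.finrank_fin_fun]
    exact h
  obtain ⟨g, hg⟩ := f.exists_leftInverse_of_injective (LinearMap.ker_eq_bot.mpr hf)
  refine ⟨LinearMap.toMatrix' (V.subtype ∘ₗ g), LinearMap.toMatrix' (f ∘ₗ π), ?_⟩
  apply Matrix.toLin'.injective
  rw [Matrix.toLin'_mul, Matrix.toLin'_mul, Matrix.toLin'_toMatrix', Matrix.toLin'_toMatrix']
  refine LinearMap.ext fun v => ?_
  have hv : Matrix.toLin' M v = V.subtype ⟨M.mulVecLin v, v, rfl⟩ := rfl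
  have h1 : ∀ y, π (V.subtype y) = y := LinearMap.congr_fun hπ
  have h2 : ∀ y, g (f y) = y := LinearMap.congr_fun hg
  simp only [LinearMap.comp_apply]
  rw [hv, h1, h2]

/-! ### Tucker products, matricizations and multilinear rank -/

section Tucker

variable {r : ℕ} {n m : Fin r → ℕ}

theorem tuckerProduct_tuckerProduct {l : Fin r → ℕ}
    (A : ∀ k, Matrix (Fin (n k)) (Fin (m k)) ℝ) (B : ∀ k, Matrix (Fin (m k)) (Fin (l k)) ℝ)
    (S : RealTensor l) :
    tuckerProduct A (tuckerProduct B S) = tuckerProduct (fun k => A k * B k) S := by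
  funext i
  simp only [tuckerProduct, Matrix.mul_apply, Fintype.prod_sum, Finset.sum_mul, Finset.mul_sum]
  rw [Finset.sum_comm]
  refine Finset.sum_congr rfl fun _ _ => Finset.sum_congr rfl fun _ _ => ?_
  rw [Finset.prod_mul_distrib, mul_assoc]

theorem tuckerProduct_one (T : RealTensor n) :
    tuckerProduct (fun k => (1 : Matrix (Fin (n k)) (Fin (n k)) ℝ)) T = T := by
  funext i
  rw [tuckerProduct, Finset.sum_eq_single i]
  · simp
  · intro j _ hj
    obtain ⟨k, hk⟩ := Function.ne_iff.mp hj
    rw [Finset.prod_eq_zero (Finset.mem_univ k) (by simp [Matrix.one_apply_ne hk.symm]), zero_mul]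
  · simp

theorem modeMatricization_injective (k : Fin r) :
    Function.Injective (modeMatricization (n := n) k) := by
  intro S T h
  funext i
  have := congrFun (congrFun h (Equiv.piSplitAt k (fun l => Fin (n l)) i).1)
    (Equiv.piSplitAt k (fun l => Fin (n l)) i).2
  simpa only [modeMatricization, Matrix.of_apply, Prod.mk.eta, Equiv.symm_apply_apply] using this

/-- The Kronecker product of the factors in all modes but `k`. -/
def kroneckerExcept (k : Fin r) (A : ∀ k, Matrix (Fin (n k)) (Fin (m k)) ℝ) :
    Matrix (∀ l : {l : Fin r // l ≠ k}, Fin (n l)) (∀ l : {l : Fin r // l ≠ k}, Fin (m l)) ℝ :=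
  Matrix.of fun i j => ∏ l : {l : Fin r // l ≠ k}, A l (i l) (j l)

theorem modeMatricization_tuckerProduct (k : Fin r)
    (A : ∀ k, Matrix (Fin (n k)) (Fin (m k)) ℝ) (S : RealTensor m) :
    modeMatricization k (tuckerProduct A S) =
      A k * modeMatricization k S * (kroneckerExcept k A).transpose := by
  ext a b
  simp only [modeMatricization, Matrix.of_apply, tuckerProduct, Matrix.mul_apply,
    Matrix.transpose_apply, kroneckerExcept, Finset.sum_mul]
  rw [← Equiv.sum_comp (Equiv.piSplitAt k fun l => Fin (m l)).symm, Fintype.sum_prod_type_right]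
  refine Finset.sum_congr rfl fun c _ => Finset.sum_congr rfl fun j _ => ?_
  rw [Fintype.prod_eq_mul_prod_subtype_ne _ k]
  have h1 : ∀ l : {l : Fin r // l ≠ k},
      A l ((Equiv.piSplitAt k fun l => Fin (n l)).symm (a, b) l)
        ((Equiv.piSplitAt k fun l => Fin (m l)).symm (j, c) l) = A l (b l) (c l) := by
    rintro ⟨l, hl⟩
    simp [Equiv.piSplitAt, hl]
  simp only [h1]
  simp only [Equiv.piSplitAt, Equiv.coe_fn_symm_mk, dite_true]
  ring

theorem kroneckerExcept_eq_one {k : Fin r} {A : ∀ k, Matrix (Fin (n k)) (Fin (n k)) ℝ}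
    (hA : ∀ l ≠ k, A l = 1) : kroneckerExcept k A = 1 := by
  ext i j
  rw [kroneckerExcept, Matrix.of_apply]
  by_cases hij : i = j
  · subst hij
    rw [Matrix.one_apply_eq]
    exact Finset.prod_eq_one fun l _ => by rw [hA _ l.2, Matrix.one_apply_eq]
  · obtain ⟨l, hl⟩ := Function.ne_iff.mp hij
    rw [Matrix.one_apply_ne hij]
    exact Finset.prod_eq_zero (Finset.mem_univ l) (by rw [hA _ l.2, Matrix.one_apply_ne hl])

/-- `C` acts as a composite of single-mode actions, each of which fixes `T`. -/
theorem tuckerProduct_eq_self_of_mul_modeMatricization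
    {C : ∀ k, Matrix (Fin (n k)) (Fin (n k)) ℝ} {T : RealTensor n}
    (h : ∀ k, C k * modeMatricization k T = modeMatricization k T) : tuckerProduct C T = T := by
  have key : ∀ s : Finset (Fin r), tuckerProduct (fun k => if k ∈ s then C k else 1) T = T := by
    intro s
    induction s using Finset.induction_on with
    | empty => simpa using tuckerProduct_one T
    | insert k s hk ih =>
      have hfac : (fun l => if l ∈ insert k s then C l else 1) =
          fun l => (if l ∈ s then C l else 1) * (if l = k then C l else 1) := by
        funext l
        by_cases hl : l = k
        · subst hl; simp [hk]
        · simp [hl]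
      rw [hfac, ← tuckerProduct_tuckerProduct (fun l => if l ∈ s then C l else 1)
        (fun l => if l = k then C l else 1)]
      have hk' : tuckerProduct (fun l => if l = k then C l else 1) T = T := by
        apply modeMatricization_injective k
        rw [modeMatricization_tuckerProduct,
          kroneckerExcept_eq_one (fun l hl => if_neg hl), Matrix.transpose_one, Matrix.mul_one,
          if_pos rfl, h]
      rw [hk', ih]
  simpa using key Finset.univ

theorem mem_tuckerVariety_iff {d : Fin r → ℕ} {T : RealTensor n} :
    T ∈ tuckerVariety n d ↔ ∀ k, (modeMatricization k T).rank ≤ d k := by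
  simp only [tuckerVariety, tuckerManifold, Set.mem_iUnion, Set.mem_ofPred_eq, Set.mem_Iic,
    exists_prop]
  exact ⟨fun ⟨d', h, h'⟩ k => (congrFun h' k).trans_le (h k), fun h => ⟨_, h, rfl⟩⟩

theorem tuckerVariety_mono {d e : Fin r → ℕ} (h : d ≤ e) :
    tuckerVariety n d ⊆ tuckerVariety n e := fun _ hT =>
  mem_tuckerVariety_iff.mpr fun k => (mem_tuckerVariety_iff.mp hT k).trans (h k)

theorem tuckerVariety_subset_tuckerImage (n m : Fin r → ℕ) :
    tuckerVariety n m ⊆ tuckerImage n m := by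
  intro T hT
  choose P Q h using fun k =>
    Matrix.exists_mul_mul_eq_of_rank_le _ (mem_tuckerVariety_iff.mp hT k)
  refine ⟨P, tuckerProduct Q T, ?_⟩
  rw [tuckerProduct_tuckerProduct, tuckerProduct_eq_self_of_mul_modeMatricization h]

theorem card_pi_ne (m : Fin r → ℕ) (k : Fin r) :
    Fintype.card (∀ l : {l : Fin r // l ≠ k}, Fin (m l)) = ∏ l ∈ Finset.univ.erase k, m l := by
  rw [Fintype.card_pi]
  simp only [Fintype.card_fin]
  exact (Finset.prod_subtype _ (by simp) _).symm

theorem tuckerImage_subset_tuckerVariety (n m : Fin r → ℕ) :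
    tuckerImage n m ⊆ tuckerVariety n (effectiveRank m) := by
  rintro T ⟨A, S, rfl⟩
  refine mem_tuckerVariety_iff.mpr fun k => ?_
  rw [modeMatricization_tuckerProduct]
  refine (Matrix.rank_mul_le_left _ _).trans ((Matrix.rank_mul_le_right _ _).trans ?_)
  refine le_min ((Matrix.rank_le_card_height _).trans_eq (Fintype.card_fin _)) ?_
  exact (Matrix.rank_le_card_width _).trans_eq (card_pi_ne m k)

theorem effectiveRank_le (m : Fin r → ℕ) : effectiveRank m ≤ m := fun _ => min_le_left _ _

theorem tuckerImage_eq_tuckerVariety (n m : Fin r → ℕ) :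
    tuckerImage n m = tuckerVariety n (effectiveRank m) :=
  (tuckerImage_subset_tuckerVariety n m).antisymm <|
    (tuckerVariety_mono (effectiveRank_le m)).trans (tuckerVariety_subset_tuckerImage n m)

theorem tuckerImage_effectiveRank (n m : Fin r → ℕ) :
    tuckerImage n (effectiveRank m) = tuckerImage n m := by
  rw [tuckerImage_eq_tuckerVariety n m]
  exact ((tuckerImage_subset_tuckerVariety _ _).trans
    (tuckerVariety_mono (effectiveRank_le _))).antisymm (tuckerVariety_subset_tuckerImage _ _)

/-- If some `l ≠ k` has its rank strictly cut down, that rank is the product of the other `m i`,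
which already contains the factor `m k`. Otherwise the bound is immediate. -/
theorem effectiveRank_le_prod_erase (m : Fin r → ℕ) (k : Fin r) :
    effectiveRank m k ≤ ∏ l ∈ Finset.univ.erase k, effectiveRank m l := by
  by_cases h0 : ∃ i, m i = 0
  · obtain ⟨i, hi⟩ := h0
    suffices effectiveRank m k = 0 by omega
    rw [effectiveRank]
    by_cases hik : i = k
    · rw [← hik, hi, Nat.zero_min]
    · rw [Finset.prod_eq_zero (Finset.mem_erase.mpr ⟨hik, Finset.mem_univ i⟩) hi, Nat.min_zero]
  have hpos : ∀ i, 0 < m i := fun i => Nat.pos_of_ne_zero fun hi => h0 ⟨i, hi⟩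
  have hprod : ∀ i, 0 < ∏ l ∈ Finset.univ.erase i, m l := fun i =>
    Finset.prod_pos fun l _ => hpos l
  by_cases h : ∀ l ∈ Finset.univ.erase k, effectiveRank m l = m l
  · rw [Finset.prod_congr rfl h]
    exact min_le_right _ _
  · push Not at h
    obtain ⟨l, hl, hlm⟩ := h
    have hkl : k ∈ Finset.univ.erase l :=
      Finset.mem_erase.mpr ⟨(Finset.ne_of_mem_erase hl).symm, Finset.mem_univ k⟩
    have hlt : ∏ i ∈ Finset.univ.erase l, m i < m l := by
      by_contra hge
      exact hlm (min_eq_left (not_lt.mp hge))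
    calc effectiveRank m k ≤ m k := min_le_left _ _
      _ ≤ ∏ i ∈ Finset.univ.erase l, m i :=
          Nat.le_of_dvd (hprod l) (Finset.dvd_prod_of_mem _ hkl)
      _ = effectiveRank m l := (min_eq_right hlt.le).symm
      _ ≤ _ := Nat.le_of_dvd (Finset.prod_pos fun i _ => lt_min (hpos i) (hprod i))
          (Finset.dvd_prod_of_mem _ hl)

end Tucker

/-! ### The standard chart: density and generic injectivity -/

section Chart

open Filter Topology

variable {r : ℕ} {n d : Fin r → ℕ}

/-- The coordinates of the standard chart of the Tucker variety: the entries of the factors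
below the identity block, and the entries of the core tensor. -/
abbrev ChartIndex (n d : Fin r → ℕ) : Type :=
  (Σ k, {i : Fin (n k) // d k ≤ (i : ℕ)} × Fin (d k)) ⊕ (∀ k, Fin (d k))

/-- The factor whose top `d k × d k` block is the identity and whose remaining entries
are given by `x`. -/
def chartFactor {R : Type} [CommRing R] (x : ChartIndex n d → R) (k : Fin r) :
    Matrix (Fin (n k)) (Fin (d k)) R :=
  Matrix.of fun i j => if h : d k ≤ (i : ℕ) then x (Sum.inl ⟨k, ⟨i, h⟩, j⟩)
    else if (i : ℕ) = j then 1 else 0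

/-- The entries of the Tucker product in the standard chart. -/
noncomputable def chartPolynomial (n d : Fin r → ℕ) (i : ∀ k, Fin (n k)) :
    MvPolynomial (ChartIndex n d) ℝ :=
  ∑ j : ∀ k, Fin (d k), (∏ k, chartFactor MvPolynomial.X k (i k) (j k)) * MvPolynomial.X (Sum.inr j)

theorem eval_chartPolynomial (x : ChartIndex n d → ℝ) (i : ∀ k, Fin (n k)) :
    MvPolynomial.eval x (chartPolynomial n d i) =
      tuckerProduct (chartFactor x) (fun j => x (Sum.inr j)) i := by
  have h : ∀ k a b, MvPolynomial.eval x (chartFactor (n := n) (d := d) MvPolynomial.X k a b) =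
      chartFactor x k a b := by
    intro k a b
    simp only [chartFactor, Matrix.of_apply]
    split_ifs <;> simp
  simp [chartPolynomial, tuckerProduct, h]

theorem chartFactor_castLE {R : Type} [CommRing R] (hd : ∀ k, d k ≤ n k)
    (x : ChartIndex n d → R) (k : Fin r) (i j : Fin (d k)) :
    chartFactor x k (Fin.castLE (hd k) i) j = if i = j then 1 else 0 := by
  simp [chartFactor, Fin.ext_iff]

/-- The invertible top blocks `U k` can be moved from the factors into the core. -/
theorem exists_chart_of_det_ne_zero (hd : ∀ k, d k ≤ n k)
    (A : ∀ k, Matrix (Fin (n k)) (Fin (d k)) ℝ) (S : RealTensor d)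
    (hA : ∀ k, ((A k).submatrix (Fin.castLE (hd k)) id).det ≠ 0) :
    ∃ x : ChartIndex n d → ℝ,
      tuckerProduct A S = tuckerProduct (chartFactor x) (fun j => x (Sum.inr j)) := by
  let U : ∀ k, Matrix (Fin (d k)) (Fin (d k)) ℝ :=
    fun k => (A k).submatrix (Fin.castLE (hd k)) id
  have hU : ∀ k, IsUnit (U k).det := fun k => (hA k).isUnit
  let x : ChartIndex n d → ℝ :=
    Sum.elim (fun b => (A b.1 * (U b.1)⁻¹) b.2.1 b.2.2) (tuckerProduct U S)
  have hx : ∀ k, chartFactor x k = A k * (U k)⁻¹ := by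
    intro k
    ext i j
    by_cases h : d k ≤ (i : ℕ)
    · simp [chartFactor, h, x]
    · obtain ⟨i, rfl⟩ : ∃ i', i = Fin.castLE (hd k) i' := ⟨⟨i, not_le.mp h⟩, rfl⟩
      rw [chartFactor_castLE, ← Matrix.one_apply, ← Matrix.mul_nonsing_inv _ (hU k)]
      rfl
  refine ⟨x, ?_⟩
  change _ = tuckerProduct (chartFactor x) (tuckerProduct U S)
  rw [tuckerProduct_tuckerProduct]
  congr 1
  funext k
  rw [hx, Matrix.nonsing_inv_mul_cancel_right _ _ (hU k)]

/-- The determinant is the characteristic polynomial of `-U` at `t`, which has finitely many roots.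
-/
theorem Matrix.eventually_det_add_smul_one_ne_zero {d : ℕ} (U : Matrix (Fin d) (Fin d) ℝ) :
    ∀ᶠ t : ℝ in 𝓝[≠] 0, (U + t • (1 : Matrix (Fin d) (Fin d) ℝ)).det ≠ 0 := by
  have hfin : {t : ℝ | (-U).charpoly.IsRoot t}.Finite :=
    Polynomial.finite_setOfPred_isRoot (-U).charpoly_monic.ne_zero
  have h : ∀ᶠ t : ℝ in 𝓝[≠] 0, t ∉ {t : ℝ | (-U).charpoly.IsRoot t} := by
    have := (hfin.subset Set.sdiff_subset : ({t : ℝ | (-U).charpoly.IsRoot t} \ {0}).Finite)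
    rw [eventually_nhdsWithin_iff]
    filter_upwards [this.isClosed.isOpen_compl.mem_nhds (by simp)] with t ht h0 hr
    exact ht ⟨hr, h0⟩
  filter_upwards [h] with t ht hdet
  apply ht
  change (-U).charpoly.eval t = 0
  rw [Matrix.eval_charpoly, sub_neg_eq_add, add_comm,
    ← hdet, Matrix.smul_one_eq_diagonal, Matrix.scalar_apply]

theorem mem_vanishingIdeal_tuckerImage_iff (hd : ∀ k, d k ≤ n k)
    (f : MvPolynomial (∀ k, Fin (n k)) ℝ) :
    f ∈ MvPolynomial.vanishingIdeal ℝ (tuckerImage n d) ↔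
      ∀ x : ChartIndex n d → ℝ,
        MvPolynomial.eval (fun i => MvPolynomial.eval x (chartPolynomial n d i)) f = 0 := by
  simp only [eval_chartPolynomial, MvPolynomial.mem_vanishingIdeal_iff, MvPolynomial.aeval_eq_eval]
  constructor
  · exact fun h x => h _ ⟨_, _, rfl⟩
  rintro h _ ⟨A, S, rfl⟩
  -- Adding `t • E k` makes all top blocks invertible for small `t ≠ 0`, so `f` vanishes there by
  -- the chart; continuity gives `t = 0`.
  let E : ∀ k, Matrix (Fin (n k)) (Fin (d k)) ℝ :=
    fun k => Matrix.of fun i j => if (i : ℕ) = j then 1 else 0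
  let F : ℝ → ℝ := fun t => MvPolynomial.eval (tuckerProduct (fun k => A k + t • E k) S) f
  have hF : Continuous F := by
    refine (MvPolynomial.continuous_eval f).comp (continuous_pi fun i => ?_)
    simp only [tuckerProduct, Matrix.add_apply, Matrix.smul_apply]
    fun_prop
  have hev : ∀ᶠ t in 𝓝[≠] (0 : ℝ), F t = 0 := by
    filter_upwards [eventually_all.mpr fun k => Matrix.eventually_det_add_smul_one_ne_zero
      ((A k).submatrix (Fin.castLE (hd k)) id)] with t ht
    obtain ⟨x, hx⟩ := exists_chart_of_det_ne_zero hd (fun k => A k + t • E k) S (by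
      intro k
      convert ht k using 2
      ext i j
      simp [E, Matrix.one_apply, Fin.ext_iff])
    simp only [F]
    rw [hx]
    exact h x
  have h0 : F 0 = 0 := tendsto_nhds_unique
    ((hF.tendsto 0).mono_left nhdsWithin_le_nhds)
    (tendsto_const_nhds.congr' (hev.mono fun _ h => h.symm))
  simpa [F] using h0

theorem chartPolynomial_castLE (hd : ∀ k, d k ≤ n k) (j : ∀ k, Fin (d k)) :
    chartPolynomial n d (fun k => Fin.castLE (hd k) (j k)) = MvPolynomial.X (Sum.inr j) := by
  rw [chartPolynomial, Finset.sum_eq_single j]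
  · simp [chartFactor_castLE]
  · intro j' _ hj
    obtain ⟨k, hk⟩ := Function.ne_iff.mp hj
    rw [Finset.prod_eq_zero (Finset.mem_univ k) (by
      rw [chartFactor_castLE, if_neg hk.symm]), zero_mul]
  · simp

/-- Identity blocks in the other modes leave linear equations for one row of the `k`-th factor, with
core entries as coefficients. -/
theorem chartPolynomial_fiber (hd : ∀ k, d k ≤ n k) (k : Fin r) (a : Fin (n k))
    (c : ∀ l : {l : Fin r // l ≠ k}, Fin (d l)) :
    chartPolynomial n d ((Equiv.piSplitAt k fun l => Fin (n l)).symm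
        (a, fun l => Fin.castLE (hd l) (c l))) =
      ∑ j, chartFactor MvPolynomial.X k a j *
        MvPolynomial.X (Sum.inr ((Equiv.piSplitAt k fun l => Fin (d l)).symm (j, c))) := by
  rw [chartPolynomial, ← Equiv.sum_comp (Equiv.piSplitAt k fun l => Fin (d l)).symm,
    Fintype.sum_prod_type_right, Finset.sum_eq_single c]
  · refine Finset.sum_congr rfl fun j _ => ?_
    rw [Fintype.prod_eq_mul_prod_subtype_ne _ k]
    have h1 : ∀ l : {l : Fin r // l ≠ k},
        chartFactor (n := n) (d := d) (MvPolynomial.X (R := ℝ)) l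
          ((Equiv.piSplitAt k fun l => Fin (n l)).symm (a, fun l => Fin.castLE (hd l) (c l)) l)
          ((Equiv.piSplitAt k fun l => Fin (d l)).symm (j, c) l) = 1 := by
      rintro ⟨l, hl⟩
      simp [Equiv.piSplitAt, hl, chartFactor_castLE]
    simp only [h1, Finset.prod_const_one, mul_one]
    simp [Equiv.piSplitAt]
  · intro c' _ hc
    obtain ⟨⟨l, hl⟩, hlc⟩ := Function.ne_iff.mp hc
    refine Finset.sum_eq_zero fun j _ => ?_
    rw [Finset.prod_eq_zero (Finset.mem_univ l) (by
      simp [Equiv.piSplitAt, hl, chartFactor_castLE, hlc.symm]), zero_mul]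
  · simp

theorem exists_mul_X_mem_range_aeval_chartPolynomial (hd : ∀ k, d k ≤ n k)
    (hprod : ∀ k, d k ≤ ∏ l ∈ Finset.univ.erase k, d l) (b : ChartIndex n d) :
    ∃ s ∈ (MvPolynomial.aeval (R := ℝ) (chartPolynomial n d)).range,
      s ≠ 0 ∧ s * MvPolynomial.X b ∈
        (MvPolynomial.aeval (R := ℝ) (chartPolynomial n d)).range := by
  set R := (MvPolynomial.aeval (R := ℝ) (chartPolynomial n d)).range
  have hR : ∀ i, chartPolynomial n d i ∈ R := fun i =>
    ⟨MvPolynomial.X i, MvPolynomial.aeval_X _ i⟩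
  have hS : ∀ j, MvPolynomial.X (Sum.inr j) ∈ R := fun j =>
    chartPolynomial_castLE hd j ▸ hR _
  rcases b with ⟨k, i, j₀⟩ | j
  -- `c` selects `d k` distinct columns of the matricized core; their determinant is the multiplier
  -- `s`.
  · obtain ⟨c⟩ : Nonempty (Fin (d k) ↪ ∀ l : {l : Fin r // l ≠ k}, Fin (d l)) :=
      Function.Embedding.nonempty_of_card_le (by
        rw [card_pi_ne, Fintype.card_fin]
        exact hprod k)
    let e := Equiv.piSplitAt k fun l => Fin (d l)
    let N : Matrix (Fin (d k)) (Fin (d k)) R :=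
      Matrix.of fun j j' => ⟨MvPolynomial.X (Sum.inr (e.symm (j, c j'))), hS _⟩
    let v : Fin (d k) → R := fun j' => ⟨_, hR ((Equiv.piSplitAt k fun l => Fin (n l)).symm
        (i, fun l => Fin.castLE (hd l) (c j' l)))⟩
    let y : Fin (d k) → MvPolynomial (ChartIndex n d) ℝ := fun j =>
      MvPolynomial.X (Sum.inl ⟨k, i, j⟩)
    have hy : Matrix.vecMul y (R.val.mapMatrix N) = fun j' => (v j' : MvPolynomial _ ℝ) := by
      funext j'
      simp only [v, chartPolynomial_fiber, Matrix.vecMul, dotProduct]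
      refine Finset.sum_congr rfl fun j _ => ?_
      simp [chartFactor, i.2, y, N, e]
    refine ⟨R.val N.det, N.det.2, ?_, ?_⟩
    · intro h0
      -- At this core the selected minor is the identity matrix, so its determinant is a nonzero
      -- polynomial.
      let x : ChartIndex n d → ℝ := Sum.elim 0 fun J => if c (e J).1 = (e J).2 then 1 else 0
      have h1 : ((MvPolynomial.eval x).mapMatrix (R.val.mapMatrix N)) = 1 := by
        ext a b
        simp [N, x, Matrix.one_apply]
      have h2 := congrArg Matrix.det h1
      rw [← RingHom.map_det, ← AlgHom.map_det, h0, map_zero, Matrix.det_one] at h2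
      exact zero_ne_one h2
    -- Cramer's rule: `det N • y` equals `v` times the adjugate, whose entries lie in `R`.
    · have h3 : Matrix.vecMul (Matrix.vecMul y (R.val.mapMatrix N))
          (R.val.mapMatrix N).adjugate = (R.val.mapMatrix N).det • y := by
        rw [Matrix.vecMul_vecMul, Matrix.mul_adjugate, Matrix.vecMul_smul, Matrix.vecMul_one]
      have h4 := congrFun h3 j₀
      rw [hy, ← AlgHom.map_adjugate, ← AlgHom.map_det, Pi.smul_apply, smul_eq_mul] at h4
      rw [← h4]
      simp only [Matrix.vecMul, dotProduct]
      exact R.sum_mem fun j _ => R.mul_mem (v j).2 (N.adjugate j j₀).2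
  · exact ⟨1, R.one_mem, one_ne_zero, by rw [one_mul]; exact hS j⟩

theorem card_chartIndex (hd : ∀ k, d k ≤ n k) :
    (Fintype.card (ChartIndex n d) : ℤ) =
      ∑ k, ((d k : ℤ) * (n k : ℤ) - (d k : ℤ) ^ 2) + ∏ k, (d k : ℤ) := by
  have h : ∀ k, Fintype.card {i : Fin (n k) // d k ≤ (i : ℕ)} = n k - d k := by
    intro k
    have h1 := Fintype.card_subtype_compl fun i : Fin (n k) => (i : ℕ) < d k
    have h2 := Fin.card_filter_val_lt (n := n k) (m := d k)
    rw [← Fintype.card_subtype] at h2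
    simpa [h2, hd k] using h1
  simp only [Fintype.card_sum, Fintype.card_sigma, Fintype.card_prod, h, Fintype.card_fin,
    Fintype.card_pi]
  push_cast [Nat.cast_sub (hd _)]
  congr 1
  exact Finset.sum_congr rfl fun k _ => by ring

theorem realAlgebraicDim_tuckerImage (hd : ∀ k, d k ≤ n k)
    (hprod : ∀ k, d k ≤ ∏ l ∈ Finset.univ.erase k, d l) :
    realAlgebraicDim (tuckerImage n d) = (Fintype.card (ChartIndex n d) : ℕ) :=
  realAlgebraicDim_eq_card _ _ (mem_vanishingIdeal_tuckerImage_iff hd)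
    (MvPolynomial.isAlgebraic_of_mul_X_mem _
      (exists_mul_X_mem_range_aeval_chartPolynomial hd hprod))

end Chart

theorem mainTheorem9 {r : ℕ} (n m : Fin r → ℕ) (hmn : ∀ k, m k ≤ n k) :
    tuckerImage n m = tuckerVariety n (effectiveRank m) ∧
      ∃ D : ℕ, realAlgebraicDim (tuckerImage n m) = (D : WithBot ℕ∞) ∧
        (D : ℤ) =
          ∑ k, ((effectiveRank m k : ℤ) * (n k : ℤ) - (effectiveRank m k : ℤ) ^ 2) +
            ∏ k, (effectiveRank m k : ℤ) := by
  have hd : ∀ k, effectiveRank m k ≤ n k := fun k => (effectiveRank_le m k).trans (hmn k)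
  refine ⟨tuckerImage_eq_tuckerVariety n m, Fintype.card (ChartIndex n (effectiveRank m)), ?_,
    card_chartIndex hd⟩
  rw [← tuckerImage_effectiveRank]
  exact realAlgebraicDim_tuckerImage hd (effectiveRank_le_prod_erase m)
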